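/- Let $n\ge 1$, let $A=(A_{ij})$ be a real symmetric and $B=(B_{ij})$ a real antisymmetric $n\times n$ matrix, and let $c_1,\dots,c_n$ be operators on a complex Hilbert space of dimension $2^n$ satisfying the canonical anticommutation relations $\{c_i,c_j\}=0$, $\{c_i,c_j^\dagger\}=\delta_{ij}$. Let $$\mathcal H_n=\sum_{i,j=1}^n\Big(A_{ij}c_i^\dagger c_j+\tfrac12B_{ij}\,(c_ic_j-c_i^\dagger c_j^\dagger)\Big),$$ let $E_{1,n}\le\dots\le E_{2^n,n}$ be its eigenvalues, counted with multiplicity, and put $K_n=\tfrac12\mathrm{Tr}\,A$, $X_n=A+B$, $$s_n=\Big(\frac1{4n}\mathrm{Tr}(X_n^TX_n)\Big)^{1/2},\qquad \rho_n^3=\frac1{8n}\mathrm{Tr}\big((X_n^TX_n)^{3/2}\big).$$ If $s_n\neq0$, then $$\sup_{E\in\mathbb R}\left|\frac1{2^n}\#\Big\{k:\frac{E_{k,n}-K_n}{\sqrt n\,s_n}<E\Big\}-\frac1{\sqrt{2\pi}}\int_{-\infty}^Ee^{-x^2/2}\,dx\right|\le\frac{C}{\sqrt n}\,\frac{\rho_n^3}{s_n^3}\qquad\text{with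 } C=6 .$$ -/

import Mathlib

noncomputable section

namespace FermiQuadratic

/-- Fermi operators `c_1, …, c_n` on a finite-dimensional complex Hilbert space: the canonical
anticommutation relations `{c_i, c_j} = 0` and `{c_i, c_j†} = δ_ij`, where `†` is the adjoint. -/
def IsFermi {V : Type*} [NormedAddCommGroup V] [InnerProductSpace ℂ V] [FiniteDimensional ℂ V]
    {n : ℕ} (c : Fin n → Module.End ℂ V) : Prop :=
  (∀ i j, c i * c j + c j * c i = 0) ∧
  (∀ i j, c i * LinearMap.adjoint (c j) + LinearMap.adjoint (c j) * c i = if i = j then 1 else 0)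

/-- The quadratic form in Fermi operators
`H_n = ∑_{i,j} (A_ij c_i† c_j + (1/2) B_ij (c_i c_j - c_i† c_j†))`. -/
def hamiltonian {V : Type*} [NormedAddCommGroup V] [InnerProductSpace ℂ V]
    [FiniteDimensional ℂ V] {n : ℕ} (A B : Matrix (Fin n) (Fin n) ℝ)
    (c : Fin n → Module.End ℂ V) : Module.End ℂ V :=
  ∑ i, ∑ j, ((A i j : ℂ) • (LinearMap.adjoint (c i) * c j) +
    ((1 / 2 : ℂ) * (B i j : ℂ)) •
      (c i * c j - LinearMap.adjoint (c i) * LinearMap.adjoint (c j)))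

/-- The quadratic form is a symmetric operator when `A` is symmetric and `B` antisymmetric. -/
theorem hamiltonian_isSymmetric {V : Type*} [NormedAddCommGroup V] [InnerProductSpace ℂ V]
    [FiniteDimensional ℂ V] {n : ℕ} {A B : Matrix (Fin n) (Fin n) ℝ}
    (hA : A.transpose = A) (hB : B.transpose = -B) (c : Fin n → Module.End ℂ V) :
    (hamiltonian A B c).IsSymmetric := by
  have hA' : ∀ i j, A j i = A i j := fun i j => congrFun (congrFun hA i) j
  have hB' : ∀ i j, B j i = -B i j := fun i j => congrFun (congrFun hB i) j
  rw [LinearMap.isSymmetric_iff_isSelfAdjoint, IsSelfAdjoint]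
  unfold hamiltonian
  rw [star_sum]
  simp only [star_sum]
  rw [Finset.sum_comm]
  refine Finset.sum_congr rfl fun i _ => Finset.sum_congr rfl fun j _ => ?_
  simp only [star_add, star_smul, star_mul, star_sub, ← LinearMap.star_eq_adjoint, star_star,
    hA' i j, hB' i j]
  simp only [RCLike.star_def, Complex.conj_ofReal, map_div₀, map_one, Complex.ofReal_neg,
    map_neg, map_ofNat]
  module

/-- The energy levels `E_{1,n} ≤ … ≤ E_{2^n,n}`: the eigenvalues of the quadratic form, listed
with multiplicity in nondecreasing order (Mathlib lists them in nonincreasing order). -/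
def energyLevel {V : Type*} [NormedAddCommGroup V] [InnerProductSpace ℂ V]
    [FiniteDimensional ℂ V] {n : ℕ} {A B : Matrix (Fin n) (Fin n) ℝ}
    (hV : Module.finrank ℂ V = 2 ^ n) (hA : A.transpose = A) (hB : B.transpose = -B)
    (c : Fin n → Module.End ℂ V) (k : Fin (2 ^ n)) : ℝ :=
  (hamiltonian_isSymmetric hA hB c).eigenvalues hV (Fin.rev k)

/-- `s_n`, the nonnegative square root of `s_n² = (1 / (4 n)) Tr (XᵀX)`. -/
def sigma {n : ℕ} (X : Matrix (Fin n) (Fin n) ℝ) : ℝ :=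
  Real.sqrt (1 / (4 * (n : ℝ)) * (X.transpose * X).trace)

/-- `ρ_n³ = (1 / (8 n)) Tr ((XᵀX)^(3/2))`; the power of the positive semidefinite matrix `XᵀX`
is taken in the continuous functional calculus. -/
def rhoCubed {n : ℕ} (X : Matrix (Fin n) (Fin n) ℝ) : ℝ :=
  1 / (8 * (n : ℝ)) * (cfc (fun x : ℝ => x ^ (3 / 2 : ℝ)) (X.transpose * X)).trace

end FermiQuadratic

end

/-!
In the Majorana operators `a_i = c_i + c_i†` and `b_i = -i (c_i - c_i†)` the quadratic form is
`Tr A / 2 + (i / 2) ∑ X_ij a_i b_j` with `X = A + B` (`hamiltonian_eq`). A singular value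
decomposition `X = ∑ λ_k p_k q_kᵀ` (`exists_svd`) rotates the two Majorana families into `α_k` and
`β_k` with the same Clifford relations, so the form becomes `Tr A / 2 + ∑ (λ_k / 2) u_k` with
commuting involutions `u_k = i α_k β_k`. Conjugation by `α_k` reverses the sign of `u_k` and fixes
the other involutions; hence, with respect to the trace, the `u_k` behave like independent fair
signs (`trace_aeval_sum_smul`). As traces of polynomials determine the eigenvalues with
multiplicity, the energy levels are the numbers `Tr A / 2 + ∑ ε_k λ_k / 2`, one for every sign
pattern (`sum_energyLevel_eq`).

The claim is thereby the Berry–Esseen inequality for `∑ ε_k a_k` with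
`a_k = λ_k / (2 √n s_n) ≥ 0`: here `∑ a_k² = 1`, and `∑ a_k³` is the right-hand side without its
constant (`signSum_berryEsseen`). It is proved by Stein's method. Let `f` be the bounded solution
of `f'(w) - w f(w) = 1_{w < z} - Φ(z)`; it lies in `[0, 4 / 3]` and is 1-Lipschitz. Write `W` for
the sum and `W_i` for the sum without its `i`-th term. Averaging over the `i`-th sign turns
`E [f'(W) - W f(W)]` into a sum over `i` of trapezoidal-rule errors on `[W_i - a_i, W_i + a_i]`.
The smooth part of these errors contributes at most `3 ∑ a_k³`. The jump at `z` contributes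
`∑ a_i² P(|W_i - z| ≤ a_i) / 2`, which is at most `(12 / 7) ∑ a_k³` by a concentration inequality
(`signSum_update_concentration`) as soon as `∑ a_k³ < 1 / 6`. Otherwise the bound is trivial.
-/

open MeasureTheory Set Filter Topology

noncomputable section

namespace FermiQuadratic

/-! ### Gaussian tails and the solution of Stein's equation -/

/-- The lower tail `∫_{-∞}^w exp (-x² / 2) dx` of the unnormalized Gaussian density. -/
def gaussLower (w : ℝ) : ℝ := ∫ x in Iic w, Real.exp (-x ^ 2 / 2)

/-- The upper tail `∫_w^∞ exp (-x² / 2) dx` of the unnormalized Gaussian density. -/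
def gaussUpper (w : ℝ) : ℝ := ∫ x in Ioi w, Real.exp (-x ^ 2 / 2)

theorem integrable_gauss : Integrable fun x : ℝ => Real.exp (-x ^ 2 / 2) := by
  have := integrable_exp_neg_mul_sq (b := 1 / 2) (by norm_num)
  refine this.congr (ae_of_all _ fun x => ?_)
  simp only
  congr 1; ring

theorem gaussLower_add_gaussUpper (w : ℝ) :
    gaussLower w + gaussUpper w = Real.sqrt (2 * Real.pi) := by
  unfold gaussLower gaussUpper
  rw [← compl_Iic, integral_add_compl measurableSet_Iic integrable_gauss]
  have := integral_gaussian (1 / 2)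
  rw [show Real.pi / (1 / 2) = 2 * Real.pi by ring] at this
  rw [← this]
  congr 1; ext x; congr 1; ring

theorem gaussLower_neg (w : ℝ) : gaussLower (-w) = gaussUpper w := by
  unfold gaussLower gaussUpper
  rw [← integral_comp_neg_Ioi]
  simp

theorem gaussUpper_neg (w : ℝ) : gaussUpper (-w) = gaussLower w := by
  rw [← gaussLower_neg, neg_neg]

theorem gaussLower_nonneg (w : ℝ) : 0 ≤ gaussLower w :=
  setIntegral_nonneg measurableSet_Iic fun _ _ => (Real.exp_pos _).le

theorem gaussUpper_nonneg (w : ℝ) : 0 ≤ gaussUpper w :=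
  setIntegral_nonneg measurableSet_Ioi fun _ _ => (Real.exp_pos _).le

theorem gaussLower_mono : Monotone gaussLower := fun _ _ h =>
  setIntegral_mono_set integrable_gauss.integrableOn
    (ae_of_all _ fun _ => (Real.exp_pos _).le) (Iic_subset_Iic.2 h).eventuallyLE

theorem gaussUpper_anti : Antitone gaussUpper := fun x y h => by
  have := gaussLower_mono h
  linarith [gaussLower_add_gaussUpper x, gaussLower_add_gaussUpper y]

theorem hasDerivAt_gaussLower (w : ℝ) :
    HasDerivAt gaussLower (Real.exp (-w ^ 2 / 2)) w := by
  have hc : Continuous fun x : ℝ => Real.exp (-x ^ 2 / 2) := by fun_prop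
  have h := (hc.integral_hasStrictDerivAt 0 w).hasDerivAt.const_add (gaussLower 0)
  refine h.congr_of_eventuallyEq (Eventually.of_forall fun x => ?_)
  have := intervalIntegral.integral_Iic_sub_Iic (μ := volume) (a := 0) (b := x)
    integrable_gauss.integrableOn integrable_gauss.integrableOn
  simp only [← this, gaussLower]
  ring

theorem hasDerivAt_gaussUpper (w : ℝ) :
    HasDerivAt gaussUpper (-Real.exp (-w ^ 2 / 2)) w := by
  refine ((hasDerivAt_gaussLower w).const_sub (Real.sqrt (2 * Real.pi))).congr_of_eventuallyEq
    (Eventually.of_forall fun x => ?_)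
  simp only
  linarith [gaussLower_add_gaussUpper x]

/-- Mills' inequality for the Gaussian tail. -/
theorem mul_gaussUpper_le (w : ℝ) : w * gaussUpper w ≤ Real.exp (-w ^ 2 / 2) := by
  have hint : Integrable fun x : ℝ => x * Real.exp (-x ^ 2 / 2) := by
    refine (integrable_mul_exp_neg_mul_sq (b := 1 / 2) (by norm_num)).congr
      (ae_of_all _ fun x => ?_)
    simp only
    congr 2; ring
  have hval : ∫ x in Ioi w, x * Real.exp (-x ^ 2 / 2) = Real.exp (-w ^ 2 / 2) := by
    have h := integral_Ioi_of_hasDerivAt_of_tendsto' (a := w) (m := 0)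
      (f := fun x : ℝ => -Real.exp (-x ^ 2 / 2)) (f' := fun x => x * Real.exp (-x ^ 2 / 2))
      (fun x _ => ?_) hint.integrableOn ?_
    · simpa using h
    · have hd := (((hasDerivAt_pow 2 x).fun_neg.div_const 2).exp).fun_neg
      refine hd.congr_deriv ?_
      push_cast; ring
    · rw [← neg_zero]
      refine Tendsto.neg (Real.tendsto_exp_atBot.comp ?_)
      have h2 : Tendsto (fun x : ℝ => x ^ 2 / 2) atTop atTop :=
        (tendsto_pow_atTop two_ne_zero).atTop_div_const two_pos
      refine (tendsto_neg_atTop_atBot.comp h2).congr fun x => ?_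
      simp; ring
  rw [← hval, gaussUpper, ← integral_const_mul]
  refine setIntegral_mono_on (integrable_gauss.const_mul w).integrableOn hint.integrableOn
    measurableSet_Ioi fun x hx => ?_
  exact mul_le_mul_of_nonneg_right (le_of_lt hx) (Real.exp_pos _).le

theorem mul_exp_mul_gaussUpper_le_one (w : ℝ) :
    w * (Real.exp (w ^ 2 / 2) * gaussUpper w) ≤ 1 := by
  have h := mul_le_mul_of_nonneg_left (mul_gaussUpper_le w) (Real.exp_pos (w ^ 2 / 2)).le
  rw [← Real.exp_add] at h
  have : w ^ 2 / 2 + -w ^ 2 / 2 = 0 := by ring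
  rw [this, Real.exp_zero] at h
  linarith

theorem hasDerivAt_exp_sq_half (w : ℝ) :
    HasDerivAt (fun x : ℝ => Real.exp (x ^ 2 / 2)) (w * Real.exp (w ^ 2 / 2)) w := by
  refine ((hasDerivAt_pow 2 w).div_const 2).exp.congr_deriv ?_
  push_cast; ring

theorem exp_mul_exp_neg_sq_half (w : ℝ) :
    Real.exp (w ^ 2 / 2) * Real.exp (-w ^ 2 / 2) = 1 := by
  rw [← Real.exp_add, ← Real.exp_zero]
  congr 1; ring

theorem hasDerivAt_exp_mul_gaussLower (w : ℝ) :
    HasDerivAt (fun x => Real.exp (x ^ 2 / 2) * gaussLower x)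
      (w * (Real.exp (w ^ 2 / 2) * gaussLower w) + 1) w := by
  refine ((hasDerivAt_exp_sq_half w).mul (hasDerivAt_gaussLower w)).congr_deriv ?_
  rw [exp_mul_exp_neg_sq_half]; ring

theorem hasDerivAt_exp_mul_gaussUpper (w : ℝ) :
    HasDerivAt (fun x => Real.exp (x ^ 2 / 2) * gaussUpper x)
      (w * (Real.exp (w ^ 2 / 2) * gaussUpper w) - 1) w := by
  refine ((hasDerivAt_exp_sq_half w).mul (hasDerivAt_gaussUpper w)).congr_deriv ?_
  rw [mul_neg, exp_mul_exp_neg_sq_half]; ring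

theorem sqrt_two_pi_pos : 0 < Real.sqrt (2 * Real.pi) := by positivity

theorem sqrt_two_pi_le : Real.sqrt (2 * Real.pi) ≤ 8 / 3 := by
  rw [Real.sqrt_le_left (by norm_num)]
  have := Real.pi_lt_d2
  linarith

theorem exp_mul_gaussUpper_le {w : ℝ} (hw : 0 ≤ w) :
    Real.exp (w ^ 2 / 2) * gaussUpper w ≤ 4 / 3 := by
  have hanti : Antitone fun x => Real.exp (x ^ 2 / 2) * gaussUpper x :=
    antitone_of_hasDerivAt_nonpos hasDerivAt_exp_mul_gaussUpper fun x =>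
      sub_nonpos.2 (mul_exp_mul_gaussUpper_le_one x)
  refine (hanti hw).trans ?_
  have h1 := gaussLower_add_gaussUpper 0
  have h2 := gaussLower_neg 0
  rw [neg_zero] at h2
  have := sqrt_two_pi_le
  norm_num
  linarith

/-- The bounded solution `f` of Stein's equation `f'(w) - w f(w) = 1_{w < z} - Φ(z)`. -/
def steinSol (z w : ℝ) : ℝ :=
  Real.exp (w ^ 2 / 2) * gaussLower (min w z) * gaussUpper (max w z) / Real.sqrt (2 * Real.pi)

theorem steinSol_of_le {z w : ℝ} (h : w ≤ z) :
    steinSol z w =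
      Real.exp (w ^ 2 / 2) * gaussLower w * (gaussUpper z / Real.sqrt (2 * Real.pi)) := by
  rw [steinSol, min_eq_left h, max_eq_right h, mul_div_assoc]

theorem steinSol_of_ge {z w : ℝ} (h : z ≤ w) :
    steinSol z w =
      Real.exp (w ^ 2 / 2) * gaussUpper w * (gaussLower z / Real.sqrt (2 * Real.pi)) := by
  rw [steinSol, min_eq_right h, max_eq_left h]; ring

theorem steinSol_neg (z w : ℝ) : steinSol (-z) (-w) = steinSol z w := by
  rw [steinSol, steinSol, min_neg_neg, max_neg_neg, gaussLower_neg, gaussUpper_neg, neg_sq]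
  ring

theorem continuous_steinSol (z : ℝ) : Continuous (steinSol z) := by
  have h1 : Continuous gaussLower :=
    continuous_iff_continuousAt.2 fun x => (hasDerivAt_gaussLower x).continuousAt
  have h2 : Continuous gaussUpper :=
    continuous_iff_continuousAt.2 fun x => (hasDerivAt_gaussUpper x).continuousAt
  unfold steinSol
  fun_prop

theorem steinSol_nonneg (z w : ℝ) : 0 ≤ steinSol z w :=
  div_nonneg (mul_nonneg (mul_nonneg (Real.exp_pos _).le (gaussLower_nonneg _))
    (gaussUpper_nonneg _)) (Real.sqrt_nonneg _)

theorem gaussUpper_div_le_one (z : ℝ) : gaussUpper z / Real.sqrt (2 * Real.pi) ≤ 1 := by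
  rw [div_le_one sqrt_two_pi_pos]
  linarith [gaussLower_add_gaussUpper z, gaussLower_nonneg z]

theorem gaussLower_div_le_one (z : ℝ) : gaussLower z / Real.sqrt (2 * Real.pi) ≤ 1 := by
  rw [← gaussUpper_neg]; exact gaussUpper_div_le_one _

theorem gaussUpper_div_nonneg (z : ℝ) : 0 ≤ gaussUpper z / Real.sqrt (2 * Real.pi) :=
  div_nonneg (gaussUpper_nonneg z) (Real.sqrt_nonneg _)

theorem gaussLower_div_nonneg (z : ℝ) : 0 ≤ gaussLower z / Real.sqrt (2 * Real.pi) :=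
  div_nonneg (gaussLower_nonneg z) (Real.sqrt_nonneg _)

theorem steinSol_le (z w : ℝ) : steinSol z w ≤ 4 / 3 := by
  wlog h : w ≤ z generalizing z w
  · rw [← steinSol_neg]
    exact this _ _ (neg_le_neg (le_of_not_ge h))
  rw [steinSol_of_le h]
  rcases le_total 0 w with hw | hw
  · have h1 := exp_mul_gaussUpper_le hw
    have h2 := gaussLower_div_le_one w
    calc Real.exp (w ^ 2 / 2) * gaussLower w * (gaussUpper z / Real.sqrt (2 * Real.pi))
        ≤ Real.exp (w ^ 2 / 2) * gaussLower w * (gaussUpper w / Real.sqrt (2 * Real.pi)) := by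
          have := gaussUpper_anti h
          have := gaussLower_nonneg w
          gcongr
      _ = (Real.exp (w ^ 2 / 2) * gaussUpper w) * (gaussLower w / Real.sqrt (2 * Real.pi)) := by
          ring
      _ ≤ 4 / 3 * 1 := mul_le_mul h1 h2 (gaussLower_div_nonneg w) (by norm_num)
      _ = 4 / 3 := mul_one _
  · have h1 := exp_mul_gaussUpper_le (neg_nonneg.2 hw)
    rw [gaussUpper_neg, neg_sq] at h1
    calc _ ≤ 4 / 3 * 1 :=
          mul_le_mul h1 (gaussUpper_div_le_one z) (gaussUpper_div_nonneg z) (by norm_num)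
      _ = 4 / 3 := mul_one _

/-- On the left of `z` the derivative of the Stein solution lies in `[0, 1]`. -/
theorem abs_deriv_steinSol_left_le {z w : ℝ} (h : w ≤ z) :
    |(w * (Real.exp (w ^ 2 / 2) * gaussLower w) + 1) *
      (gaussUpper z / Real.sqrt (2 * Real.pi))| ≤ 1 := by
  have hlow : 0 ≤ w * (Real.exp (w ^ 2 / 2) * gaussLower w) + 1 := by
    have := mul_exp_mul_gaussUpper_le_one (-w)
    rw [gaussUpper_neg, neg_sq] at this
    linarith
  rw [abs_of_nonneg (mul_nonneg hlow (gaussUpper_div_nonneg z))]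
  rcases le_total w 0 with hw | hw
  · refine mul_le_one₀ ?_ (gaussUpper_div_nonneg z) (gaussUpper_div_le_one z)
    have := mul_nonneg (neg_nonneg.2 hw)
      (mul_nonneg (Real.exp_pos (w ^ 2 / 2)).le (gaussLower_nonneg w))
    linarith
  · rw [← mul_div_assoc, div_le_one sqrt_two_pi_pos, ← gaussLower_add_gaussUpper z]
    have h1 : w * (Real.exp (w ^ 2 / 2) * gaussUpper z) ≤ 1 := by
      refine le_trans ?_ (mul_exp_mul_gaussUpper_le_one w)
      have := gaussUpper_anti h
      gcongr
    have h2 := mul_le_mul h1 (gaussLower_mono h) (gaussLower_nonneg w) zero_le_one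
    linarith

theorem hasDerivAt_steinSol_left (z w : ℝ) :
    HasDerivAt (fun x => Real.exp (x ^ 2 / 2) * gaussLower x *
        (gaussUpper z / Real.sqrt (2 * Real.pi)))
      ((w * (Real.exp (w ^ 2 / 2) * gaussLower w) + 1) *
        (gaussUpper z / Real.sqrt (2 * Real.pi))) w :=
  (hasDerivAt_exp_mul_gaussLower w).mul_const _

theorem abs_steinSol_sub_le_of_le {z x y : ℝ} (hx : x ≤ z) (hy : y ≤ z) :
    |steinSol z x - steinSol z y| ≤ |x - y| := by
  have h := (convex_Iic z).norm_image_sub_le_of_norm_hasDerivWithin_le (C := 1)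
    (fun w _ => (hasDerivAt_steinSol_left z w).hasDerivWithinAt)
    (fun w hw => abs_deriv_steinSol_left_le hw) hy hx
  rw [one_mul] at h
  rw [steinSol_of_le hx, steinSol_of_le hy]
  exact h

theorem abs_steinSol_sub_le_of_ge {z x y : ℝ} (hx : z ≤ x) (hy : z ≤ y) :
    |steinSol z x - steinSol z y| ≤ |x - y| := by
  have := abs_steinSol_sub_le_of_le (neg_le_neg hx) (neg_le_neg hy)
  rwa [steinSol_neg, steinSol_neg, neg_sub_neg, abs_sub_comm y x] at this

theorem abs_steinSol_sub_le (z x y : ℝ) : |steinSol z x - steinSol z y| ≤ |x - y| := by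
  wlog hxy : x ≤ y generalizing x y
  · rw [abs_sub_comm, abs_sub_comm x y]
    exact this _ _ (le_of_not_ge hxy)
  rcases le_total y z with hy | hy
  · exact abs_steinSol_sub_le_of_le (hxy.trans hy) hy
  rcases le_total z x with hx | hx
  · exact abs_steinSol_sub_le_of_ge hx hy
  have h1 := abs_steinSol_sub_le_of_le hx le_rfl
  have h2 := abs_steinSol_sub_le_of_ge le_rfl hy
  rw [abs_of_nonpos (sub_nonpos.2 hx)] at h1
  rw [abs_of_nonpos (sub_nonpos.2 hy)] at h2
  rw [abs_of_nonpos (sub_nonpos.2 hxy)]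
  linarith [abs_sub_le (steinSol z x) (steinSol z z) (steinSol z y)]

/-- Stein's equation with the jump at `z` integrated out: subtracting a primitive of
`1_{w < z} - Φ(z)` from the solution leaves a differentiable function, also at `z`. -/
theorem hasDerivAt_steinSol_sub (z w : ℝ) :
    HasDerivAt (fun x => steinSol z x -
        (min x z - gaussLower z / Real.sqrt (2 * Real.pi) * x)) (w * steinSol z w) w := by
  have hsum : gaussUpper z / Real.sqrt (2 * Real.pi) =
      1 - gaussLower z / Real.sqrt (2 * Real.pi) := by
    rw [eq_sub_iff_add_eq, ← add_div, add_comm, gaussLower_add_gaussUpper,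
      div_self sqrt_two_pi_pos.ne']
  have hne : ∀ y ≠ z, HasDerivAt (fun x => steinSol z x -
      (min x z - gaussLower z / Real.sqrt (2 * Real.pi) * x)) (y * steinSol z y) y := by
    intro y hy
    rcases lt_or_gt_of_ne hy with h | h
    · have h1 := (hasDerivAt_steinSol_left z y).sub ((hasDerivAt_id y).sub
        ((hasDerivAt_id y).const_mul (gaussLower z / Real.sqrt (2 * Real.pi))))
      refine HasDerivAt.congr_deriv (h1.congr_of_eventuallyEq ?_) ?_
      · filter_upwards [Iio_mem_nhds h] with x hx
        have hx' : x ≤ z := le_of_lt (mem_Iio.1 hx)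
        simp [steinSol_of_le hx', min_eq_left hx']
      · rw [steinSol_of_le h.le, hsum]; ring
    · have h1 := ((hasDerivAt_exp_mul_gaussUpper y).mul_const
        (gaussLower z / Real.sqrt (2 * Real.pi))).sub ((hasDerivAt_const y z).sub
        ((hasDerivAt_id y).const_mul (gaussLower z / Real.sqrt (2 * Real.pi))))
      refine HasDerivAt.congr_deriv (h1.congr_of_eventuallyEq ?_) ?_
      · filter_upwards [Ioi_mem_nhds h] with x hx
        have hx' : z ≤ x := le_of_lt (mem_Ioi.1 hx)
        simp [steinSol_of_ge hx', min_eq_right hx']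
      · rw [steinSol_of_ge h.le]; ring
  rcases eq_or_ne w z with rfl | h
  · have hc := continuous_steinSol w
    exact hasDerivAt_of_hasDerivAt_of_ne' hne (by fun_prop) (by fun_prop) w
  · exact hne w h

/-- For a sign variable the two values `w ± a` replace the uniform average over `[w - a, w + a]`
in Stein's identity; this is the error of that trapezoidal rule for the derivative
`x f(x) + 1_{x < z} - Φ(z)` of the Stein solution. The jump at `z` only contributes when `z` lies
within `a` of `w`. -/
theorem abs_trapezoid_steinSol_le (z w : ℝ) {a : ℝ} (ha : 0 ≤ a) :
    |a * ((w + a) * steinSol z (w + a) + (if w + a < z then 1 else 0) -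
          gaussLower z / Real.sqrt (2 * Real.pi) +
        ((w - a) * steinSol z (w - a) + (if w - a < z then 1 else 0) -
          gaussLower z / Real.sqrt (2 * Real.pi))) -
      (steinSol z (w + a) - steinSol z (w - a))| ≤
      a ^ 2 * (2 * |w| + 4) + a * (if |w - z| ≤ a then 1 else 0) := by
  rcases ha.eq_or_lt with rfl | ha'
  · simp
  set Φ := gaussLower z / Real.sqrt (2 * Real.pi)
  obtain ⟨ξ, hξ, hslope⟩ := exists_hasDerivAt_eq_slope
    (fun x => steinSol z x - (min x z - Φ * x)) (fun x => x * steinSol z x)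
    (a := w - a) (b := w + a) (by linarith)
    (fun x _ => (hasDerivAt_steinSol_sub z x).continuousAt.continuousWithinAt)
    (fun x _ => hasDerivAt_steinSol_sub z x)
  obtain ⟨t, rfl⟩ : ∃ t, ξ = w + t := ⟨ξ - w, by ring⟩
  have ht1 : -a < t := by linarith [hξ.1]
  have ht2 : t < a := by linarith [hξ.2]
  rw [eq_div_iff (by linarith)] at hslope
  have hjump : |a * ((if w + a < z then 1 else 0) + (if w - a < z then 1 else 0)) -
      (min (w + a) z - min (w - a) z)| ≤ a * (if |w - z| ≤ a then 1 else 0) := by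
    rcases lt_or_ge (w + a) z with h1 | h1
    · have h2 : w - a < z := by linarith
      rw [if_pos h1, if_pos h2, min_eq_left h1.le, min_eq_left h2.le,
        show a * (1 + 1) - (w + a - (w - a)) = 0 by ring, abs_zero]
      split_ifs <;> linarith
    rcases lt_or_ge (w - a) z with h2 | h2
    · have h3 : |w - z| ≤ a := abs_le.2 ⟨by linarith, by linarith⟩
      rw [if_neg h1.not_gt, if_pos h2, if_pos h3, min_eq_right h1, min_eq_left h2.le,
        show a * (0 + 1) - (z - (w - a)) = w - z by ring]
      linarith
    · rw [if_neg h1.not_gt, if_neg h2.not_gt, min_eq_right h1, min_eq_right h2]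
      simp only [add_zero, mul_zero, sub_self, abs_zero]
      split_ifs <;> linarith
  have hsmooth : |a * ((w + a) * steinSol z (w + a) + (w - a) * steinSol z (w - a)) -
      2 * a * ((w + t) * steinSol z (w + t))| ≤ a ^ 2 * (2 * |w| + 4) := by
    have e : a * ((w + a) * steinSol z (w + a) + (w - a) * steinSol z (w - a)) -
        2 * a * ((w + t) * steinSol z (w + t)) =
        a * (w * ((steinSol z (w + a) - steinSol z (w + t)) +
            (steinSol z (w - a) - steinSol z (w + t))) +
          (a * (steinSol z (w + a) - steinSol z (w - a)) - 2 * t * steinSol z (w + t))) := by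
      ring
    have l1 : |steinSol z (w + a) - steinSol z (w + t)| ≤ a - t := by
      refine (abs_steinSol_sub_le z _ _).trans_eq ?_
      rw [show w + a - (w + t) = a - t by ring, abs_of_nonneg (by linarith)]
    have l2 : |steinSol z (w - a) - steinSol z (w + t)| ≤ a + t := by
      refine (abs_steinSol_sub_le z _ _).trans_eq ?_
      rw [show w - a - (w + t) = -(a + t) by ring, abs_neg, abs_of_nonneg (by linarith)]
    have l3 : |steinSol z (w + a) - steinSol z (w - a)| ≤ 4 / 3 :=
      abs_le.2 ⟨by linarith [steinSol_nonneg z (w + a), steinSol_le z (w - a)],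
        by linarith [steinSol_nonneg z (w - a), steinSol_le z (w + a)]⟩
    have l4 : |t * steinSol z (w + t)| ≤ a * (4 / 3) := by
      rw [abs_mul, abs_of_nonneg (steinSol_nonneg z _)]
      exact mul_le_mul (abs_le.2 ⟨ht1.le, ht2.le⟩) (steinSol_le z _) (steinSol_nonneg z _) ha
    have l5 : |w * ((steinSol z (w + a) - steinSol z (w + t)) +
        (steinSol z (w - a) - steinSol z (w + t)))| ≤ |w| * (2 * a) := by
      rw [abs_mul]
      refine mul_le_mul_of_nonneg_left ((abs_add_le _ _).trans ?_) (abs_nonneg w)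
      linarith
    have l6 : |a * (steinSol z (w + a) - steinSol z (w - a))| ≤ a * (4 / 3) := by
      rw [abs_mul, abs_of_nonneg ha]
      exact mul_le_mul_of_nonneg_left l3 ha
    rw [e, abs_mul, abs_of_nonneg ha]
    have l7 : |w * ((steinSol z (w + a) - steinSol z (w + t)) +
          (steinSol z (w - a) - steinSol z (w + t))) +
        (a * (steinSol z (w + a) - steinSol z (w - a)) - 2 * t * steinSol z (w + t))| ≤
        a * (2 * |w| + 4) := by
      rw [abs_le] at *
      constructor <;> linarith
    calc _ ≤ a * (a * (2 * |w| + 4)) := mul_le_mul_of_nonneg_left l7 ha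
      _ = _ := by ring
  refine le_trans (le_of_eq ?_) ((abs_add_le _ _).trans (add_le_add hsmooth hjump))
  congr 1
  linear_combination hslope

/-! ### Weighted sums of random signs -/

/-- The weighted sum `∑ i, ε_i a_i` of a sign pattern `ε`; a random sign sum is this function on
the sign patterns with their uniform distribution. -/
def signSum {ι : Type*} [Fintype ι] (a : ι → ℝ) (ε : ι → ℤˣ) : ℝ := ∑ i, ((ε i : ℤ) : ℝ) * a i

/-- The sign pattern `ε` with the sign at `i` reversed. -/
def flipSign {ι : Type*} [DecidableEq ι] (i : ι) (ε : ι → ℤˣ) : ι → ℤˣ := ε * Pi.mulSingle i (-1)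

theorem flipSign_same {ι : Type*} [DecidableEq ι] (i : ι) (ε : ι → ℤˣ) : flipSign i ε i = -ε i := by
  simp [flipSign]

theorem flipSign_of_ne {ι : Type*} [DecidableEq ι] {i j : ι} (h : j ≠ i) (ε : ι → ℤˣ) :
    flipSign i ε j = ε j := by
  simp [flipSign, Pi.mulSingle_eq_of_ne h]

section SignSum

variable {ι : Type*} [Fintype ι] [DecidableEq ι]

theorem sum_flipSign {M : Type*} [AddCommMonoid M] (i : ι) (F : (ι → ℤˣ) → M) :
    ∑ ε, F (flipSign i ε) = ∑ ε, F ε :=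
  Fintype.sum_equiv (Equiv.mulRight (Pi.mulSingle i (-1))) _ _ fun _ => rfl

theorem card_signs : (Fintype.card (ι → ℤˣ) : ℝ) = 2 ^ Fintype.card ι := by
  simp [Fintype.card_units_int]

/-- Averaging first over the sign at `i`. -/
theorem sum_sign_split {R : Type*} [Field R] [CharZero R] (i : ι) (g : ℤ → (ι → ℤˣ) → R)
    (hg : ∀ s ε, g s (flipSign i ε) = g s ε) :
    ∑ ε, g (ε i : ℤ) ε = 1 / 2 * ∑ ε, (g 1 ε + g (-1) ε) := by
  have h1 : ∑ ε, g (ε i : ℤ) ε = ∑ ε, g (-(ε i : ℤ)) ε := by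
    rw [← sum_flipSign i]
    refine Finset.sum_congr rfl fun ε _ => ?_
    rw [hg, flipSign_same, Units.val_neg]
  have h2 : ∑ ε, (g 1 ε + g (-1) ε) = ∑ ε, (g (ε i : ℤ) ε + g (-(ε i : ℤ)) ε) := by
    refine Finset.sum_congr rfl fun ε _ => ?_
    rcases Int.units_eq_one_or (ε i) with h | h <;> simp [h, add_comm]
  rw [h2, Finset.sum_add_distrib, ← h1]
  ring

theorem sum_sign_mul_eq_zero (i : ι) (G : (ι → ℤˣ) → ℝ) (hG : ∀ ε, G (flipSign i ε) = G ε) :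
    ∑ ε : ι → ℤˣ, ((ε i : ℤ) : ℝ) * G ε = 0 := by
  rw [sum_sign_split i (fun s ε => (s : ℝ) * G ε) fun s ε => by rw [hG]]
  simp

theorem signSum_eq_add_update (a : ι → ℝ) (i : ι) (ε : ι → ℤˣ) :
    signSum a ε = signSum (Function.update a i 0) ε + ((ε i : ℤ) : ℝ) * a i := by
  unfold signSum
  rw [← Finset.sum_erase_add _ _ (Finset.mem_univ i), ← Finset.sum_erase_add
    _ (fun j => ((ε j : ℤ) : ℝ) * Function.update a i 0 j) (Finset.mem_univ i)]
  simp only [Function.update_self, mul_zero, add_zero, add_left_inj]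
  refine Finset.sum_congr rfl fun j hj => ?_
  rw [Function.update_of_ne (Finset.ne_of_mem_erase hj)]

theorem signSum_update_flipSign (a : ι → ℝ) (i : ι) (ε : ι → ℤˣ) :
    signSum (Function.update a i 0) (flipSign i ε) = signSum (Function.update a i 0) ε := by
  refine Finset.sum_congr rfl fun j _ => ?_
  rcases eq_or_ne j i with rfl | h
  · simp
  · rw [flipSign_of_ne h]

/-- Expanding one factor of a random sign sum; subtracting the value with the `i`-th weight
removed does not change the mean. -/
theorem sum_signSum_mul (a : ι → ℝ) (f : ℝ → ℝ) :
    ∑ ε, signSum a ε * f (signSum a ε) = ∑ i, ∑ ε : ι → ℤˣ, ((ε i : ℤ) : ℝ) * a i *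
      (f (signSum a ε) - f (signSum (Function.update a i 0) ε)) := by
  have h : ∀ ε, signSum a ε * f (signSum a ε) =
      ∑ i, ((ε i : ℤ) : ℝ) * a i * f (signSum a ε) := fun ε => by
    conv_lhs => rw [signSum]
    rw [← Finset.sum_mul]
    rfl
  simp_rw [h]
  rw [Finset.sum_comm]
  refine Finset.sum_congr rfl fun i _ => ?_
  have h0 := sum_sign_mul_eq_zero i
    (fun ε => a i * f (signSum (Function.update a i 0) ε))
    fun ε => by rw [signSum_update_flipSign]
  simp_rw [mul_sub, Finset.sum_sub_distrib]
  simp_rw [← mul_assoc] at h0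
  rw [h0, sub_zero]

theorem sum_signSum_sq (a : ι → ℝ) :
    ∑ ε, signSum a ε ^ 2 = 2 ^ Fintype.card ι * ∑ i, a i ^ 2 := by
  have h := sum_signSum_mul a id
  simp only [id, ← pow_two] at h
  rw [h, Finset.mul_sum]
  refine Finset.sum_congr rfl fun i _ => ?_
  rw [← card_signs, ← nsmul_eq_mul, ← Finset.card_univ, ← Finset.sum_const]
  refine Finset.sum_congr rfl fun ε _ => ?_
  rw [signSum_eq_add_update a i]
  rcases Int.units_eq_one_or (ε i) with h | h <;> simp [h] <;> ring

theorem sum_abs_signSum_le {a : ι → ℝ} (ha : ∑ i, a i ^ 2 ≤ 1) :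
    ∑ ε, |signSum a ε| ≤ 2 ^ Fintype.card ι := by
  have h1 : ∑ ε, |signSum a ε| ≤ ∑ ε : ι → ℤˣ, (1 + signSum a ε ^ 2) / 2 := by
    refine Finset.sum_le_sum fun ε _ => ?_
    have := sq_nonneg (|signSum a ε| - 1)
    rw [sub_sq, sq_abs] at this
    linarith
  rw [← Finset.sum_div, Finset.sum_add_distrib, sum_signSum_sq, Finset.sum_const, nsmul_eq_mul,
    Finset.card_univ, card_signs] at h1
  have : (2 : ℝ) ^ Fintype.card ι * ∑ i, a i ^ 2 ≤ 2 ^ Fintype.card ι * 1 := by gcongr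
  linarith

/-- A concentration inequality for random sign sums: testing Stein's identity on the truncation of
`w - z` to `[-(r + α), r + α]` bounds the probability of the interval of radius `r` about `z`. -/
theorem signSum_concentration {b : ι → ℝ} (hb : ∀ i, 0 ≤ b i) (hb2 : ∑ i, b i ^ 2 ≤ 1)
    (z : ℝ) {r α : ℝ} (hr : 0 ≤ r) (hα : 0 ≤ α) :
    (∑ ε, if |signSum b ε - z| ≤ r then (1 : ℝ) else 0) * ∑ i, b i * min α (b i) ≤
      2 ^ Fintype.card ι * (r + α) := by
  set f : ℝ → ℝ := fun w => max (-(r + α)) (min (w - z) (r + α)) with hf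
  have hmono : Monotone f := fun x y h =>
    max_le_max le_rfl (min_le_min (sub_le_sub_right h z) le_rfl)
  have hbd : ∀ w, |f w| ≤ r + α := fun w =>
    abs_le.2 ⟨le_max_left _ _, max_le (by linarith) (min_le_right _ _)⟩
  have hupper : ∑ ε, signSum b ε * f (signSum b ε) ≤ 2 ^ Fintype.card ι * (r + α) := by
    refine le_trans (Finset.sum_le_sum (g := fun ε => |signSum b ε| * (r + α)) fun ε _ => ?_) ?_
    · refine (le_abs_self _).trans ?_
      rw [abs_mul]
      exact mul_le_mul_of_nonneg_left (hbd _) (abs_nonneg _)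
    · rw [← Finset.sum_mul]
      exact mul_le_mul_of_nonneg_right (sum_abs_signSum_le hb2) (by linarith)
  refine le_trans ?_ hupper
  rw [sum_signSum_mul, Finset.mul_sum]
  refine Finset.sum_le_sum fun i _ => ?_
  rw [Finset.sum_mul]
  refine Finset.sum_le_sum fun ε _ => ?_
  set W := signSum b ε
  have hW : signSum (Function.update b i 0) ε = W - ((ε i : ℤ) : ℝ) * b i := by
    rw [eq_sub_iff_add_eq, ← signSum_eq_add_update]
  rw [hW]
  have hbi := hb i
  have key : ∀ s : ℝ, s = 1 ∨ s = -1 →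
      (if |W - z| ≤ r then 1 else 0) * min α (b i) ≤ s * (f W - f (W - s * b i)) := by
    intro s hs
    split_ifs with h
    · rw [abs_le] at h
      have hfW : f W = W - z := by
        rw [hf]
        simp only
        rw [min_eq_left (by linarith [h.2]), max_eq_right (by linarith [h.1])]
      rcases hs with rfl | rfl
      · rw [hfW, one_mul, one_mul, one_mul, le_sub_comm]
        refine max_le ?_ ((min_le_left _ _).trans ?_)
        · linarith [min_le_left α (b i), h.1]
        · linarith [min_le_right α (b i)]
      · have : W - z + min α (b i) ≤ f (W - -1 * b i) :=
          (le_min (by linarith [min_le_right α (b i)])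
            (by linarith [min_le_left α (b i), h.2])).trans (le_max_right _ _)
        rw [hfW]; linarith
    · rw [zero_mul]
      rcases hs with rfl | rfl
      · linarith [hmono (show W - 1 * b i ≤ W by linarith)]
      · linarith [hmono (show W ≤ W - -1 * b i by linarith)]
  have hs : ((ε i : ℤ) : ℝ) = 1 ∨ ((ε i : ℤ) : ℝ) = -1 := by
    rcases Int.units_eq_one_or (ε i) with h | h <;> simp [h]
  have := mul_le_mul_of_nonneg_left (key _ hs) hbi
  linarith

/-- If `γ = ∑ a_i³` is small, then even with one weight removed a random sign sum has `O(γ + r)`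
concentration on intervals of radius `r`. -/
theorem signSum_update_concentration {a : ι → ℝ} (ha : ∀ i, 0 ≤ a i) (ha2 : ∑ i, a i ^ 2 = 1)
    {γ : ℝ} (hγ : ∑ i, a i ^ 3 = γ) (hγ0 : 0 < γ) (hγ1 : γ ≤ 1 / 6) (z : ℝ) (i : ι) {r : ℝ}
    (hr : 0 ≤ r) :
    (∑ ε, if |signSum (Function.update a i 0) ε - z| ≤ r then (1 : ℝ) else 0) ≤
      2 ^ Fintype.card ι * (12 / 7 * (r + γ)) := by
  set b := Function.update a i 0 with hb
  have hba : ∀ j, 0 ≤ b j ∧ b j ≤ a j := by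
    intro j
    rcases eq_or_ne j i with rfl | h
    · simpa [hb] using ha j
    · simp [hb, h, ha j]
  have hb2 : ∑ j, b j ^ 2 ≤ 1 := by
    rw [← ha2]
    exact Finset.sum_le_sum fun j _ => pow_le_pow_left₀ (hba j).1 (hba j).2 2
  have hai : a i ≤ 1 := by
    have h := Finset.single_le_sum (f := fun j => a j ^ 2) (fun j _ => sq_nonneg _)
      (Finset.mem_univ i)
    simp only [ha2] at h
    exact (abs_le_one_iff_mul_self_le_one.2 (by rwa [← pow_two])) |> (le_abs_self _).trans
  have hmin : ∀ x : ℝ, 0 ≤ x → x ^ 2 - x ^ 3 / (4 * γ) ≤ x * min γ x := by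
    intro x hx
    rcases le_total γ x with h | h
    · -- `x γ - x² + x³ / (4 γ) = x (2 γ - x)² / (4 γ)`
      rw [min_eq_left h]
      have : x * γ - (x ^ 2 - x ^ 3 / (4 * γ)) = x * (2 * γ - x) ^ 2 / (4 * γ) := by
        field_simp; ring
      have : 0 ≤ x * (2 * γ - x) ^ 2 / (4 * γ) := by positivity
      linarith
    · rw [min_eq_right h]
      have : 0 ≤ x ^ 3 / (4 * γ) := by positivity
      linarith
  have hM : 7 / 12 ≤ ∑ j, b j * min γ (b j) := by
    have h1 : ∑ j, a j * min γ (a j) = ∑ j, b j * min γ (b j) + a i * min γ (a i) := by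
      rw [← Finset.sum_erase_add _ _ (Finset.mem_univ i), ← Finset.sum_erase_add
        _ (fun j => b j * min γ (b j)) (Finset.mem_univ i)]
      have : b i = 0 := by simp [hb]
      rw [this, zero_mul, add_zero, add_left_inj]
      refine Finset.sum_congr rfl fun j hj => ?_
      rw [hb, Function.update_of_ne (Finset.ne_of_mem_erase hj)]
    have h2 : ∑ j, (a j ^ 2 - a j ^ 3 / (4 * γ)) ≤ ∑ j, a j * min γ (a j) :=
      Finset.sum_le_sum fun j _ => hmin _ (ha j)
    rw [Finset.sum_sub_distrib, ← Finset.sum_div, ha2, hγ,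
      show γ / (4 * γ) = 1 / 4 by field_simp] at h2
    have h3 : a i * min γ (a i) ≤ 1 * (1 / 6) :=
      mul_le_mul hai ((min_le_left _ _).trans hγ1) (le_min hγ0.le (ha i)) zero_le_one
    linarith
  have hconc := signSum_concentration (fun j => (hba j).1) hb2 z hr hγ0.le
  have hnn : 0 ≤ ∑ ε, if |signSum b ε - z| ≤ r then (1 : ℝ) else 0 :=
    Finset.sum_nonneg fun ε _ => by split_ifs <;> norm_num
  have := mul_le_mul_of_nonneg_left hM hnn
  linarith

/-- **Berry–Esseen inequality** for weighted sums of random signs. -/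
theorem signSum_berryEsseen {a : ι → ℝ} (ha : ∀ i, 0 ≤ a i) (ha2 : ∑ i, a i ^ 2 = 1) (z : ℝ) :
    |1 / 2 ^ Fintype.card ι * (∑ ε, if signSum a ε < z then (1 : ℝ) else 0) -
      gaussLower z / Real.sqrt (2 * Real.pi)| ≤ 6 * ∑ i, a i ^ 3 := by
  set Φ := gaussLower z / Real.sqrt (2 * Real.pi) with hΦ
  set N : ℝ := 2 ^ Fintype.card ι with hN
  set γ := ∑ i, a i ^ 3 with hγ
  have hN0 : 0 < N := by positivity
  have hcard : ∑ _ε : ι → ℤˣ, (1 : ℝ) = N := by simp [hN]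
  rcases le_or_gt (1 / 6) γ with hγ1 | hγ1
  · -- both terms lie in `[0, 1]`
    have h1 : (∑ ε, if signSum a ε < z then (1 : ℝ) else 0) ≤ N := by
      rw [← hcard]
      exact Finset.sum_le_sum fun ε _ => by split_ifs <;> norm_num
    have h0 : 0 ≤ ∑ ε, if signSum a ε < z then (1 : ℝ) else 0 :=
      Finset.sum_nonneg fun ε _ => by split_ifs <;> norm_num
    have h2 : 1 / N * (∑ ε, if signSum a ε < z then (1 : ℝ) else 0) ≤ 1 := by
      rw [one_div_mul_eq_div, div_le_one hN0]; exact h1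
    have h3 : 0 ≤ 1 / N * (∑ ε, if signSum a ε < z then (1 : ℝ) else 0) := by positivity
    have h4 := gaussLower_div_le_one z
    have h5 := gaussLower_div_nonneg z
    rw [abs_le]
    constructor <;> linarith
  have hγ0 : 0 < γ := by
    refine (Finset.sum_nonneg fun i _ => pow_nonneg (ha i) 3).lt_of_ne fun h => ?_
    have h' := (Finset.sum_eq_zero_iff_of_nonneg fun i _ => pow_nonneg (ha i) 3).1 h.symm
    have : ∑ i, a i ^ 2 = 0 := Finset.sum_eq_zero fun i hi => by
      rw [pow_eq_zero_iff three_ne_zero |>.1 (h' i hi)]; norm_num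
    linarith
  set D : ℝ → ℝ := fun x => x * steinSol z x + (if x < z then 1 else 0) - Φ with hD
  set W : ι → (ι → ℤˣ) → ℝ := fun i => signSum (Function.update a i 0) with hW
  have hWf : ∀ i ε, W i (flipSign i ε) = W i ε := fun i ε => signSum_update_flipSign a i ε
  have hsplit : ∀ i, ∑ ε, D (signSum a ε) =
      1 / 2 * ∑ ε, (D (W i ε + a i) + D (W i ε - a i)) := by
    intro i
    have := sum_sign_split i (fun s ε => D (W i ε + (s : ℝ) * a i)) fun s ε => by rw [hWf]
    simp only [Int.cast_one, one_mul, Int.cast_neg, neg_mul, ← sub_eq_add_neg] at this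
    rw [← this]
    exact Finset.sum_congr rfl fun ε _ => by rw [signSum_eq_add_update a i]
  have hstein : ∑ ε, signSum a ε * steinSol z (signSum a ε) =
      ∑ i, 1 / 2 * (a i * ∑ ε, (steinSol z (W i ε + a i) - steinSol z (W i ε - a i))) := by
    rw [sum_signSum_mul]
    refine Finset.sum_congr rfl fun i _ => ?_
    have := sum_sign_split i (fun s ε => (s : ℝ) * a i *
      (steinSol z (W i ε + (s : ℝ) * a i) - steinSol z (W i ε))) fun s ε => by rw [hWf]
    rw [Finset.mul_sum]
    refine Eq.trans ?_ (this.trans ?_)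
    · exact Finset.sum_congr rfl fun ε _ => by rw [signSum_eq_add_update a i]
    · congr 1
      refine Finset.sum_congr rfl fun ε _ => ?_
      simp only [Int.cast_one, one_mul, Int.cast_neg, neg_mul, ← sub_eq_add_neg]
      ring
  -- weight `∑ i, a i ^ 2 = 1` distributes `D` over the indices, so that it pairs with `hstein`
  have hmain : (∑ ε, if signSum a ε < z then (1 : ℝ) else 0) - N * Φ =
      ∑ i, 1 / 2 * (a i * ∑ ε, (a i * (D (W i ε + a i) + D (W i ε - a i)) -
        (steinSol z (W i ε + a i) - steinSol z (W i ε - a i)))) := by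
    have h1 : (∑ ε, if signSum a ε < z then (1 : ℝ) else 0) - N * Φ =
        ∑ ε, D (signSum a ε) - ∑ ε, signSum a ε * steinSol z (signSum a ε) := by
      rw [← hcard, Finset.sum_mul, ← Finset.sum_sub_distrib, ← Finset.sum_sub_distrib]
      refine Finset.sum_congr rfl fun ε _ => ?_
      simp only [hD]; ring
    have h2 : ∑ ε, D (signSum a ε) = ∑ i, a i ^ 2 * ∑ ε, D (signSum a ε) := by
      rw [← Finset.sum_mul, ha2, one_mul]
    rw [h1, hstein, h2, ← Finset.sum_sub_distrib]
    refine Finset.sum_congr rfl fun i _ => ?_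
    rw [hsplit i, Finset.sum_sub_distrib _ (fun ε => steinSol z (W i ε + a i) - _),
      ← Finset.mul_sum]
    ring
  have hterm : ∀ i, |1 / 2 * (a i * ∑ ε, (a i * (D (W i ε + a i) + D (W i ε - a i)) -
        (steinSol z (W i ε + a i) - steinSol z (W i ε - a i))))| ≤
      N * (27 / 7 * a i ^ 3 + 6 / 7 * γ * a i ^ 2) := by
    intro i
    have hb2 : ∑ j, Function.update a i 0 j ^ 2 ≤ 1 := by
      rw [← ha2]
      refine Finset.sum_le_sum fun j _ => ?_
      rcases eq_or_ne j i with rfl | h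
      · simpa using sq_nonneg (a j)
      · simp [h]
    have hsum : |∑ ε, (a i * (D (W i ε + a i) + D (W i ε - a i)) -
        (steinSol z (W i ε + a i) - steinSol z (W i ε - a i)))| ≤
        N * (6 * a i ^ 2 + 12 / 7 * (a i * (a i + γ))) := by
      refine (Finset.abs_sum_le_sum_abs _ _).trans ((Finset.sum_le_sum fun ε _ =>
        abs_trapezoid_steinSol_le z (W i ε) (ha i)).trans ?_)
      have h1 := sum_abs_signSum_le hb2
      have h2 := signSum_update_concentration ha ha2 hγ.symm hγ0 hγ1.le z i (ha i)
      have h3 : ∑ ε, (2 * |W i ε| + 4) ≤ 6 * N := by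
        rw [Finset.sum_add_distrib, ← Finset.mul_sum]
        have : ∑ _ε : ι → ℤˣ, (4 : ℝ) = 4 * N := by
          rw [← hcard, Finset.mul_sum]; simp
        rw [this]; linarith
      rw [Finset.sum_add_distrib, ← Finset.mul_sum, ← Finset.mul_sum]
      have h4 := mul_le_mul_of_nonneg_left h3 (sq_nonneg (a i))
      have h5 := mul_le_mul_of_nonneg_left h2 (ha i)
      linarith
    rw [abs_mul, abs_mul, abs_of_nonneg (ha i), abs_of_pos (by norm_num : (0 : ℝ) < 1 / 2)]
    have := mul_le_mul_of_nonneg_left hsum (ha i)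
    linarith
  have hfinal : |(∑ ε, if signSum a ε < z then (1 : ℝ) else 0) - N * Φ| ≤ N * (6 * γ) := by
    rw [hmain]
    refine (Finset.abs_sum_le_sum_abs _ _).trans ((Finset.sum_le_sum fun i _ => hterm i).trans ?_)
    rw [← Finset.mul_sum, Finset.sum_add_distrib, ← Finset.mul_sum, ← Finset.mul_sum, ha2, ← hγ]
    refine mul_le_mul_of_nonneg_left ?_ hN0.le
    linarith
  have e : 1 / N * (∑ ε, if signSum a ε < z then (1 : ℝ) else 0) - Φ =
      ((∑ ε, if signSum a ε < z then (1 : ℝ) else 0) - N * Φ) / N := by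
    field_simp
  rw [e, abs_div, abs_of_pos hN0, div_le_iff₀ hN0]
  linarith

end SignSum

/-! ### Traces of polynomials in commuting involutions -/

section Trace

variable {V : Type*} [AddCommGroup V] [Module ℂ V]

theorem aeval_mul_eq_mul_aeval {A : Type*} [Ring A] [Algebra ℂ A] {T T' e : A}
    (h : T * e = e * T') (p : Polynomial ℂ) :
    Polynomial.aeval T p * e = e * Polynomial.aeval T' p := by
  induction p using Polynomial.induction_on' with
  | add p q hp hq => rw [map_add, map_add, add_mul, mul_add, hp, hq]
  | monomial m c =>
    have hm : T ^ m * e = e * T' ^ m := by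
      have h' : SemiconjBy e T' T := h.symm
      exact (h'.pow_right m).eq.symm
    simp only [Polynomial.aeval_monomial, Algebra.algebraMap_eq_smul_one, smul_mul_assoc, one_mul,
      mul_smul_comm, hm]

/-- If the involution `u` commutes with `S`, and some involution `α` commutes with `S` but
anticommutes with `u`, then `u` takes the values `1` and `-1` with equal weight, independently
of `S`. -/
theorem trace_aeval_add_smul {S u α : Module.End ℂ V} (hu : u * u = 1) (hα : α * α = 1)
    (hαu : α * u = -(u * α)) (hSu : Commute S u) (hSα : Commute S α) (x : ℂ)
    (p : Polynomial ℂ) :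
    LinearMap.trace ℂ V (Polynomial.aeval (S + x • u) p) =
      1 / 2 * (LinearMap.trace ℂ V (Polynomial.aeval (S + x • 1) p) +
        LinearMap.trace ℂ V (Polynomial.aeval (S + (-x) • 1) p)) := by
  have hzero : ∀ y : ℂ,
      LinearMap.trace ℂ V (Polynomial.aeval (S + y • 1) p * u) = 0 := by
    intro y
    set q := Polynomial.aeval (S + y • (1 : Module.End ℂ V)) p with hq
    have hqα : q * α = α * q := aeval_mul_eq_mul_aeval (by
      rw [add_mul, mul_add, hSα.eq, smul_mul_assoc, mul_smul_comm, one_mul, mul_one]) p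
    have h1 : q * u = -(α * (q * u * α)) := by
      rw [← mul_assoc, ← mul_assoc, ← hqα, mul_assoc q, hαu, mul_neg, neg_mul, neg_neg, ← mul_assoc,
        mul_assoc, hα, mul_one]
    have h2 : LinearMap.trace ℂ V (α * (q * u * α)) = LinearMap.trace ℂ V (q * u) := by
      rw [LinearMap.trace_mul_comm, mul_assoc, hα, mul_one]
    have h3 := congrArg (LinearMap.trace ℂ V) h1
    rw [map_neg, h2] at h3
    exact self_eq_neg.1 h3
  -- `u` acts as the scalar `s` on the range of `1 + s u`, for `s = 1` and `s = -1`
  have hproj : ∀ s : ℂ, s * s = 1 →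
      Polynomial.aeval (S + x • u) p * (1 + s • u) =
        Polynomial.aeval (S + (s * x) • 1) p * (1 + s • u) := by
    intro s hs
    have hcomm : (S + (s * x) • (1 : Module.End ℂ V)) * (1 + s • u) =
        (1 + s • u) * (S + (s * x) • 1) := by
      simp only [add_mul, mul_add, mul_one, one_mul, smul_mul_assoc, mul_smul_comm, hSu.eq]
      module
    have hact : (S + x • u) * (1 + s • u) = (S + (s * x) • 1) * (1 + s • u) := by
      simp only [add_mul, mul_add, mul_one, one_mul, smul_mul_assoc, mul_smul_comm, hu, smul_add,
        smul_smul]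
      rw [show s * (s * x) = x by rw [← mul_assoc, hs, one_mul]]
      abel
    rw [aeval_mul_eq_mul_aeval (hact.trans hcomm), aeval_mul_eq_mul_aeval hcomm]
  have h1 := congrArg (LinearMap.trace ℂ V) (hproj 1 (by norm_num))
  have h2 := congrArg (LinearMap.trace ℂ V) (hproj (-1) (by norm_num))
  simp only [mul_add, mul_one, mul_smul_comm, map_add, map_smul, hzero, smul_eq_mul, one_mul,
    neg_mul, mul_zero, add_zero] at h1 h2
  linear_combination (1 / 2 : ℂ) * h1 + (1 / 2 : ℂ) * h2

/-- A linear combination `y + ∑ x_i u_i` of independent commuting involutions has, with respect to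
the trace, the distribution of the random sign sum `y + ∑ ε_i x_i`. -/
theorem trace_aeval_sum_smul [FiniteDimensional ℂ V] {ι : Type*} [Fintype ι] [DecidableEq ι]
    (hV : Module.finrank ℂ V = 2 ^ Fintype.card ι) {u α : ι → Module.End ℂ V}
    (hu : ∀ i, u i * u i = 1) (hα : ∀ i, α i * α i = 1) (hαu : ∀ i, α i * u i = -(u i * α i))
    (huu : ∀ i j, i ≠ j → Commute (u i) (u j)) (hαu' : ∀ i j, i ≠ j → Commute (u i) (α j))
    (x : ι → ℂ) (p : Polynomial ℂ) (s : Finset ι) (y : ℂ) :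
    LinearMap.trace ℂ V (Polynomial.aeval (y • 1 + ∑ i ∈ s, x i • u i) p) =
      ∑ ε : ι → ℤˣ, p.eval (y + ∑ i ∈ s, ((ε i : ℤ) : ℂ) * x i) := by
  induction s using Finset.induction_on generalizing y with
  | empty =>
    simp only [Finset.sum_empty, add_zero, Finset.sum_const, nsmul_eq_mul]
    rw [← Algebra.algebraMap_eq_smul_one, Polynomial.aeval_algebraMap_apply,
      Algebra.algebraMap_eq_smul_one, map_smul, LinearMap.trace_one, hV]
    simp [Fintype.card_units_int, mul_comm]
  | insert k s hk ih =>
    have hmem : ∀ i ∈ s, i ≠ k := fun i hi h => hk (h ▸ hi)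
    have h1 : Commute (y • 1 + ∑ i ∈ s, x i • u i) (u k) :=
      ((Commute.one_left _).smul_left y).add_left (Commute.sum_left _ _ _ fun i hi =>
        (huu i k (hmem i hi)).smul_left _)
    have h2 : Commute (y • 1 + ∑ i ∈ s, x i • u i) (α k) :=
      ((Commute.one_left _).smul_left y).add_left (Commute.sum_left _ _ _ fun i hi =>
        (hαu' i k (hmem i hi)).smul_left _)
    have hsplit := sum_sign_split k (fun σ ε =>
      p.eval (y + ((σ : ℂ) * x k + ∑ i ∈ s, ((ε i : ℤ) : ℂ) * x i))) fun σ ε => by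
        refine congrArg (fun t => p.eval (y + (_ + t))) (Finset.sum_congr rfl fun i hi => ?_)
        rw [flipSign_of_ne (hmem i hi)]
    simp only [Finset.sum_insert hk]
    rw [hsplit, add_comm (x k • u k), ← add_assoc,
      trace_aeval_add_smul (hu k) (hα k) (hαu k) h1 h2, add_right_comm, ← add_smul, ih,
      add_right_comm, ← add_smul, ih, Finset.sum_add_distrib]
    simp [add_assoc]

end Trace

/-! ### Majorana operators -/

section Majorana

theorem mul_self_eq_one_of_anticomm {A ι : Type*} [Ring A] [Algebra ℂ A] [DecidableEq ι]
    {a : ι → A}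
    (ha : ∀ i j, a i * a j + a j * a i = if i = j then 2 else 0) (i : ι) : a i * a i = 1 := by
  have h := ha i i
  rw [if_pos rfl, ← two_smul ℂ] at h
  have h2 := congrArg (fun t => (1 / 2 : ℂ) • t) h
  simp only [smul_smul] at h2
  norm_num at h2
  rw [h2, show (2 : A) = (2 : ℂ) • 1 by rw [two_smul]; norm_num, smul_smul]
  norm_num

theorem mul_eq_neg_of_anticomm {A ι : Type*} [Ring A] [DecidableEq ι] {a : ι → A}
    (ha : ∀ i j, a i * a j + a j * a i = if i = j then 2 else 0) {i j : ι} (h : i ≠ j) :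
    a i * a j = -(a j * a i) := by
  have := ha i j
  rw [if_neg h] at this
  exact eq_neg_of_add_eq_zero_left this

variable {A : Type*} [Ring A] [Algebra ℂ A] {ι : Type*} [Fintype ι]

theorem sum_smul_anticomm (a b : ι → A) (p q : ι → ℂ) :
    (∑ i, p i • a i) * (∑ j, q j • b j) + (∑ j, q j • b j) * (∑ i, p i • a i) =
      ∑ i, ∑ j, (p i * q j) • (a i * b j + b j * a i) := by
  rw [Finset.sum_mul_sum, Finset.sum_mul_sum, Finset.sum_comm (s := Finset.univ (α := ι))
    (f := fun j i => q j • b j * p i • a i), ← Finset.sum_add_distrib]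
  refine Finset.sum_congr rfl fun i _ => ?_
  rw [← Finset.sum_add_distrib]
  refine Finset.sum_congr rfl fun j _ => ?_
  rw [smul_mul_smul_comm, smul_mul_smul_comm, mul_comm (q j), smul_add]

variable [DecidableEq ι]

/-- Orthogonal transformations preserve the Clifford relations. -/
theorem rotate_anticomm {a : ι → A}
    (ha : ∀ i j, a i * a j + a j * a i = if i = j then 2 else 0) {P : Matrix ι ι ℝ}
    (hP : P.transpose * P = 1) (k l : ι) :
    (∑ i, (P i k : ℂ) • a i) * (∑ i, (P i l : ℂ) • a i) +
      (∑ i, (P i l : ℂ) • a i) * (∑ i, (P i k : ℂ) • a i) = if k = l then 2 else 0 := by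
  rw [sum_smul_anticomm]
  have h := congrFun (congrFun hP k) l
  rw [Matrix.mul_apply, Matrix.one_apply] at h
  simp only [Matrix.transpose_apply] at h
  have h' : ∑ i, (P i k : ℂ) * (P i l : ℂ) = if k = l then 1 else 0 := by
    rw [← Complex.ofReal_one, ← Complex.ofReal_zero, ← apply_ite Complex.ofReal, ← h]
    push_cast; rfl
  simp only [ha, smul_ite, smul_zero, Finset.sum_ite_eq, Finset.mem_univ, if_true]
  rw [← Finset.sum_smul, h']
  split_ifs <;> simp

end Majorana

/-! ### Singular values and traces of matrix functions -/

theorem trace_cfc {ι : Type*} [Fintype ι] [DecidableEq ι] {M : Matrix ι ι ℝ}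
    (hM : M.IsHermitian) (f : ℝ → ℝ) : (cfc f M).trace = ∑ i, f (hM.eigenvalues i) := by
  rw [hM.cfc_eq, Matrix.IsHermitian.cfc, Unitary.conjStarAlgAut_apply, Matrix.trace_mul_cycle,
    Unitary.coe_star_mul_self, one_mul, Matrix.trace_diagonal]
  rfl

/-- **Singular value decomposition** of a real square matrix, together with the power sums of the
singular values. -/
theorem exists_svd {ι : Type*} [Fintype ι] [DecidableEq ι] (X : Matrix ι ι ℝ) :
    ∃ (P Q : Matrix ι ι ℝ) (l : ι → ℝ), P.transpose * P = 1 ∧ Q.transpose * Q = 1 ∧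
      (∀ k, 0 ≤ l k) ∧ (∀ i j, X i j = ∑ k, l k * (P i k * Q j k)) ∧
      (∑ k, l k ^ 2 = (X.transpose * X).trace) ∧
      (∑ k, l k ^ 3 = (cfc (fun x : ℝ => x ^ (3 / 2 : ℝ)) (X.transpose * X)).trace) := by
  have hpsd : (X.transpose * X).PosSemidef := by
    have := Matrix.posSemidef_conjTranspose_mul_self X
    rwa [Matrix.conjTranspose_eq_transpose_of_trivial] at this
  set hM := hpsd.isHermitian
  set μ := hM.eigenvalues with hμ
  have hμ0 : ∀ k, 0 ≤ μ k := hpsd.eigenvalues_nonneg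
  set b := hM.eigenvectorBasis with hb
  have hbinner : ∀ k m, (b k).ofLp ⬝ᵥ (b m).ofLp = if k = m then 1 else 0 := by
    intro k m
    have h := orthonormal_iff_ite.1 b.orthonormal m k
    rw [EuclideanSpace.inner_eq_star_dotProduct] at h
    simpa [eq_comm] using h
  have hXinner : ∀ k m, (X.mulVec (b k).ofLp) ⬝ᵥ (X.mulVec (b m).ofLp) =
      if k = m then μ k else 0 := by
    intro k m
    rw [Matrix.dotProduct_mulVec, ← Matrix.mulVec_transpose, Matrix.mulVec_mulVec,
      hM.mulVec_eigenvectorBasis, smul_dotProduct, hbinner]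
    simp [hμ]
  set v : ι → EuclideanSpace ℝ ι := fun k =>
    (Real.sqrt (μ k))⁻¹ • WithLp.toLp 2 (X.mulVec (b k).ofLp) with hv
  have hvo : Orthonormal ℝ (({k | μ k ≠ 0} : Set ι).domRestrict v) := by
    rw [orthonormal_iff_ite]
    rintro ⟨k, hk⟩ ⟨m, hm⟩
    simp only [Set.domRestrict_apply, hv, inner_smul_left, inner_smul_right,
      EuclideanSpace.inner_eq_star_dotProduct, star_trivial, hXinner, Subtype.mk.injEq]
    rcases eq_or_ne m k with rfl | h
    · have hm' : Real.sqrt (μ m) ≠ 0 := Real.sqrt_ne_zero'.2 ((hμ0 m).lt_of_ne' hm)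
      simp only [if_true, conj_trivial]
      rw [← mul_assoc, ← mul_inv, Real.mul_self_sqrt (hμ0 m), inv_mul_cancel₀ hm]
    · simp [h, h.symm]
  obtain ⟨w, hw⟩ := hvo.exists_orthonormalBasis_extension_of_card_eq (by simp)
  have hwinner : ∀ k m, (w k).ofLp ⬝ᵥ (w m).ofLp = if k = m then 1 else 0 := by
    intro k m
    have h := orthonormal_iff_ite.1 w.orthonormal m k
    rw [EuclideanSpace.inner_eq_star_dotProduct] at h
    simpa [eq_comm] using h
  have hXb : ∀ k i, X.mulVec (b k).ofLp i = Real.sqrt (μ k) * w k i := by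
    intro k i
    by_cases hk : μ k = 0
    · have h := hXinner k k
      rw [if_pos rfl, hk, dotProduct_self_eq_zero] at h
      simp [h, hk]
    · have hk' : Real.sqrt (μ k) ≠ 0 := Real.sqrt_ne_zero'.2 ((hμ0 k).lt_of_ne' hk)
      rw [hw k hk, hv]
      simp [hk']
  set P : Matrix ι ι ℝ := Matrix.of fun i k => w k i with hP
  set Q : Matrix ι ι ℝ := Matrix.of fun j k => b k j with hQ
  have hQQ : Q.transpose * Q = 1 := by
    ext k m
    rw [Matrix.one_apply, ← hbinner k m]; rfl
  refine ⟨P, Q, fun k => Real.sqrt (μ k), ?_, hQQ, fun k => Real.sqrt_nonneg _, ?_, ?_, ?_⟩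
  · ext k m
    rw [Matrix.one_apply, ← hwinner k m]; rfl
  · intro i j
    have h : X = X * Q * Q.transpose := by
      rw [Matrix.mul_assoc, mul_eq_one_comm.1 hQQ, Matrix.mul_one]
    conv_lhs => rw [h, Matrix.mul_apply]
    refine Finset.sum_congr rfl fun k _ => ?_
    have : (X * Q) i k = X.mulVec (b k).ofLp i := rfl
    rw [this, hXb, mul_assoc]; rfl
  · rw [hM.trace_eq_sum_eigenvalues]
    exact Finset.sum_congr rfl fun k _ => Real.sq_sqrt (hμ0 k)
  · rw [trace_cfc hM]
    refine Finset.sum_congr rfl fun k _ => ?_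
    change Real.sqrt (μ k) ^ 3 = μ k ^ (3 / 2 : ℝ)
    rw [Real.sqrt_eq_rpow, ← Real.rpow_natCast, ← Real.rpow_mul (hμ0 k)]
    norm_num

/-- Two finite families of real numbers with the same polynomial power sums have the same sums of
arbitrary functions, by interpolation. -/
theorem sum_eq_sum_of_forall_polynomial {κ κ' : Type*} [Fintype κ] [Fintype κ'] {x : κ → ℝ}
    {y : κ' → ℝ}
    (h : ∀ p : Polynomial ℂ, ∑ k, p.eval (x k : ℂ) = ∑ k, p.eval (y k : ℂ)) (f : ℝ → ℝ) :
    ∑ k, f (x k) = ∑ k, f (y k) := by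
  classical
  set F : Finset ℂ := Finset.univ.image (fun k => (x k : ℂ)) ∪
    Finset.univ.image (fun k => (y k : ℂ)) with hF
  set p := Lagrange.interpolate F id (fun z => (f z.re : ℂ)) with hp
  have hpx : ∀ t : ℝ, (t : ℂ) ∈ F → p.eval (t : ℂ) = f t := fun t ht => by
    have := Lagrange.eval_interpolate_at_node (fun z : ℂ => (f z.re : ℂ)) (s := F) (v := id)
      Function.injective_id.injOn ht
    simpa only [id, Complex.ofReal_re] using this
  have h1 := h p
  rw [Finset.sum_congr rfl fun k _ => hpx (x k) (by simp [hF]),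
    Finset.sum_congr rfl fun k _ => hpx (y k) (by simp [hF])] at h1
  exact_mod_cast h1

theorem trace_aeval_of_isSymmetric {V : Type*} [NormedAddCommGroup V] [InnerProductSpace ℂ V]
    [FiniteDimensional ℂ V] {m : ℕ} {T : Module.End ℂ V} (hT : T.IsSymmetric)
    (hV : Module.finrank ℂ V = m) (p : Polynomial ℂ) :
    LinearMap.trace ℂ V (Polynomial.aeval T p) = ∑ k, p.eval (hT.eigenvalues hV k : ℂ) := by
  rw [LinearMap.trace_eq_matrix_trace ℂ (hT.eigenvectorBasis hV).toBasis, Matrix.trace]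
  refine Finset.sum_congr rfl fun k _ => ?_
  rw [Matrix.diag_apply, LinearMap.toMatrix_apply, OrthonormalBasis.coe_toBasis,
    Module.End.aeval_apply_of_mem_apply_eq_smul (hT.apply_eigenvectorBasis hV k)]
  simp

/-! ### The spectrum of the quadratic form -/

section Hamiltonian

variable {V : Type*} [NormedAddCommGroup V] [InnerProductSpace ℂ V] [FiniteDimensional ℂ V] {n : ℕ}

/-- The first family `c_i + c_i†` of Majorana operators. -/
def majoranaA (c : Fin n → Module.End ℂ V) (i : Fin n) : Module.End ℂ V :=
  c i + LinearMap.adjoint (c i)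

/-- The second family `-i (c_i - c_i†)` of Majorana operators. -/
def majoranaB (c : Fin n → Module.End ℂ V) (i : Fin n) : Module.End ℂ V :=
  (-Complex.I) • (c i - LinearMap.adjoint (c i))

theorem IsFermi.adjoint_mul_adjoint {c : Fin n → Module.End ℂ V} (hc : IsFermi c) (i j : Fin n) :
    LinearMap.adjoint (c i) * LinearMap.adjoint (c j) =
      -(LinearMap.adjoint (c j) * LinearMap.adjoint (c i)) := by
  have h := congrArg star (hc.1 i j)
  simp only [star_add, star_mul, star_zero, LinearMap.star_eq_adjoint] at h
  exact eq_neg_of_add_eq_zero_right h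

theorem IsFermi.mul_eq_neg {c : Fin n → Module.End ℂ V} (hc : IsFermi c) (i j : Fin n) :
    c i * c j = -(c j * c i) :=
  eq_neg_of_add_eq_zero_left (hc.1 i j)

theorem IsFermi.mul_adjoint {c : Fin n → Module.End ℂ V} (hc : IsFermi c) (i j : Fin n) :
    c i * LinearMap.adjoint (c j) =
      (if i = j then 1 else 0) - LinearMap.adjoint (c j) * c i :=
  eq_sub_of_add_eq (hc.2 i j)

theorem IsFermi.majoranaA_anticomm {c : Fin n → Module.End ℂ V} (hc : IsFermi c) (i j : Fin n) :
    majoranaA c i * majoranaA c j + majoranaA c j * majoranaA c i = if i = j then 2 else 0 := by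
  simp only [majoranaA, add_mul, mul_add]
  rw [hc.mul_eq_neg i j, hc.adjoint_mul_adjoint i j, hc.mul_adjoint i j, hc.mul_adjoint j i]
  rcases eq_or_ne i j with rfl | h
  · simp only [if_true, ← one_add_one_eq_two]; abel
  · simp only [if_neg h, if_neg h.symm]; abel

theorem IsFermi.majoranaB_anticomm {c : Fin n → Module.End ℂ V} (hc : IsFermi c) (i j : Fin n) :
    majoranaB c i * majoranaB c j + majoranaB c j * majoranaB c i = if i = j then 2 else 0 := by
  simp only [majoranaB, smul_mul_smul_comm, neg_mul_neg, Complex.I_mul_I, neg_smul, one_smul,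
    sub_mul, mul_sub]
  rw [hc.mul_eq_neg i j, hc.adjoint_mul_adjoint i j, hc.mul_adjoint i j, hc.mul_adjoint j i]
  rcases eq_or_ne i j with rfl | h
  · simp only [if_true, ← one_add_one_eq_two]; abel
  · simp only [if_neg h, if_neg h.symm]; abel

theorem IsFermi.majoranaA_mul_majoranaB {c : Fin n → Module.End ℂ V} (hc : IsFermi c)
    (i j : Fin n) : majoranaA c i * majoranaB c j = -(majoranaB c j * majoranaA c i) := by
  simp only [majoranaA, majoranaB, mul_smul_comm, smul_mul_assoc, add_mul, mul_add, sub_mul,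
    mul_sub]
  rw [hc.mul_eq_neg i j, hc.adjoint_mul_adjoint i j, hc.mul_adjoint i j, hc.mul_adjoint j i]
  rcases eq_or_ne i j with rfl | h
  · simp only [if_true]; module
  · simp only [if_neg h, if_neg h.symm]; module

/-- In Majorana operators the quadratic form is `Tr A / 2 + (i / 2) ∑ X_ij a_i b_j` with
`X = A + B`. -/
theorem hamiltonian_eq {A B : Matrix (Fin n) (Fin n) ℝ} (hA : A.transpose = A)
    (hB : B.transpose = -B) {c : Fin n → Module.End ℂ V} (hc : IsFermi c) :
    hamiltonian A B c = ((A.trace / 2 : ℝ) : ℂ) • 1 +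
      ∑ i, ∑ j, (((A + B) i j / 2 : ℝ) : ℂ) • Complex.I • (majoranaA c i * majoranaB c j) := by
  have hA' : ∀ i j, A j i = A i j := fun i j => congrFun (congrFun hA i) j
  have hB' : ∀ i j, B j i = -B i j := fun i j => congrFun (congrFun hB i) j
  -- the two double sums agree after symmetrization in `i` and `j`
  have hsymm : ∀ F G : Fin n → Fin n → Module.End ℂ V,
      (∀ i j, F i j + F j i = G i j + G j i) → ∑ i, ∑ j, F i j = ∑ i, ∑ j, G i j := by
    intro F G h
    have h2 : ∀ F : Fin n → Fin n → Module.End ℂ V,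
        (2 : ℂ) • ∑ i, ∑ j, F i j = ∑ i, ∑ j, (F i j + F j i) := by
      intro F
      simp only [Finset.sum_add_distrib]
      rw [two_smul, Finset.sum_comm (f := fun i j => F j i)]
    have : (2 : ℂ) • ∑ i, ∑ j, F i j = (2 : ℂ) • ∑ i, ∑ j, G i j := by
      rw [h2, h2]; simp only [h]
    exact smul_right_injective _ two_ne_zero this
  have htr : ((A.trace / 2 : ℝ) : ℂ) • (1 : Module.End ℂ V) =
      ∑ i, ∑ j, ((A i j / 2 : ℝ) : ℂ) • (if i = j then (1 : Module.End ℂ V) else 0) := by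
    simp only [smul_ite, smul_zero, Finset.sum_ite_eq, Finset.mem_univ, if_true]
    rw [← Finset.sum_smul, Matrix.trace, Finset.sum_div]
    push_cast; rfl
  rw [htr, ← Finset.sum_add_distrib]
  simp only [← Finset.sum_add_distrib]
  refine hsymm _ _ fun i j => ?_
  have hI : Complex.I * -Complex.I = 1 := by rw [mul_neg, Complex.I_mul_I, neg_neg]
  simp only [majoranaA, majoranaB, mul_smul_comm, smul_smul, hI, mul_one, add_mul,
    mul_sub, Matrix.add_apply, hA' i j, hB' i j]
  rw [hc.mul_eq_neg j i, hc.adjoint_mul_adjoint j i, hc.mul_adjoint i j, hc.mul_adjoint j i]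
  push_cast
  rcases eq_or_ne i j with rfl | h
  · simp only [if_true]; module
  · simp only [if_neg h, if_neg h.symm]; module

/-- The energy levels are the values `Tr A / 2 + ∑ ε_k λ_k / 2` over all sign patterns, for any
singular value decomposition `A + B = ∑ λ_k p_k q_kᵀ`; sums of arbitrary functions encode the
equality of the two families with multiplicity. -/
theorem sum_energyLevel_eq (hV : Module.finrank ℂ V = 2 ^ n) {c : Fin n → Module.End ℂ V}
    (hc : IsFermi c) {A B : Matrix (Fin n) (Fin n) ℝ} (hA : A.transpose = A)
    (hB : B.transpose = -B) {P Q : Matrix (Fin n) (Fin n) ℝ} {l : Fin n → ℝ}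
    (hP : P.transpose * P = 1) (hQ : Q.transpose * Q = 1)
    (hX : ∀ i j, (A + B) i j = ∑ k, l k * (P i k * Q j k)) (f : ℝ → ℝ) :
    ∑ k, f (energyLevel hV hA hB c k) =
      ∑ ε, f (A.trace / 2 + signSum (fun k => l k / 2) ε) := by
  have hrev : ∑ k, f (energyLevel hV hA hB c k) =
      ∑ k, f ((hamiltonian_isSymmetric hA hB c).eigenvalues hV k) :=
    Equiv.sum_comp Fin.revPerm (fun k => f ((hamiltonian_isSymmetric hA hB c).eigenvalues hV k))
  rw [hrev]
  refine sum_eq_sum_of_forall_polynomial (fun p => ?_) f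
  rw [← trace_aeval_of_isSymmetric]
  set α : Fin n → Module.End ℂ V := fun k => ∑ i, (P i k : ℂ) • majoranaA c i with hα
  set β : Fin n → Module.End ℂ V := fun k => ∑ i, (Q i k : ℂ) • majoranaB c i with hβ
  have hαα : ∀ i j, α i * α j + α j * α i = if i = j then 2 else 0 :=
    rotate_anticomm hc.majoranaA_anticomm hP
  have hββ : ∀ i j, β i * β j + β j * β i = if i = j then 2 else 0 :=
    rotate_anticomm hc.majoranaB_anticomm hQ
  have hαβ : ∀ i j, α i * β j = -(β j * α i) := by
    intro i j
    refine eq_neg_of_add_eq_zero_left ?_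
    rw [hα, hβ]
    simp only
    rw [sum_smul_anticomm]
    refine Finset.sum_eq_zero fun k _ => Finset.sum_eq_zero fun m _ => ?_
    rw [hc.majoranaA_mul_majoranaB, neg_add_cancel, smul_zero]
  have hα1 := mul_self_eq_one_of_anticomm hαα
  have hβ1 := mul_self_eq_one_of_anticomm hββ
  set u : Fin n → Module.End ℂ V := fun k => Complex.I • (α k * β k) with hu
  have hH : hamiltonian A B c =
      ((A.trace / 2 : ℝ) : ℂ) • 1 + ∑ k, ((l k / 2 : ℝ) : ℂ) • u k := by
    rw [hamiltonian_eq hA hB hc, add_right_inj]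
    have h1 : ∀ k, ((l k / 2 : ℝ) : ℂ) • u k = ∑ i, ∑ j,
        (((l k * (P i k * Q j k)) / 2 : ℝ) : ℂ) •
          Complex.I • (majoranaA c i * majoranaB c j) := by
      intro k
      simp only [hu, hα, hβ]
      rw [Finset.sum_mul_sum]
      simp only [Finset.smul_sum]
      refine Finset.sum_congr rfl fun i _ => Finset.sum_congr rfl fun j _ => ?_
      rw [smul_mul_smul_comm, smul_smul, smul_smul, smul_smul]
      congr 1
      push_cast; ring
    simp only [h1]
    symm
    rw [Finset.sum_comm]
    refine Finset.sum_congr rfl fun i _ => ?_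
    rw [Finset.sum_comm]
    refine Finset.sum_congr rfl fun j _ => ?_
    rw [← Finset.sum_smul, hX, Finset.sum_div]
    push_cast; rfl
  have hu1 : ∀ k, u k * u k = 1 := by
    intro k
    simp only [hu]
    rw [smul_mul_smul_comm, Complex.I_mul_I, mul_assoc, ← mul_assoc (β k), ← neg_eq_iff_eq_neg.2
      (hαβ k k), neg_mul, mul_neg, ← mul_assoc, ← mul_assoc, hα1, one_mul, hβ1]
    simp
  have hαu : ∀ k, α k * u k = -(u k * α k) := by
    intro k
    simp only [hu, mul_smul_comm, smul_mul_assoc]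
    rw [← smul_neg, mul_assoc (α k) (β k), ← mul_neg, ← hαβ]
  have hαβu : ∀ i j, i ≠ j → Commute (u i) (α j) ∧ Commute (u i) (β j) := by
    intro i j hij
    constructor
    · refine Commute.smul_left ?_ _
      change α i * β i * α j = α j * (α i * β i)
      rw [mul_assoc, ← neg_eq_iff_eq_neg.2 (hαβ j i), mul_neg, ← mul_assoc,
        mul_eq_neg_of_anticomm hαα hij, neg_mul, neg_neg, mul_assoc]
    · refine Commute.smul_left ?_ _
      change α i * β i * β j = β j * (α i * β i)
      rw [mul_assoc, mul_eq_neg_of_anticomm hββ hij, mul_neg, ← mul_assoc, hαβ, neg_mul, neg_neg,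
        mul_assoc]
  have huu : ∀ i j, i ≠ j → Commute (u i) (u j) := fun i j hij =>
    ((hαβu i j hij).1.mul_right (hαβu i j hij).2).smul_right _
  rw [hH, trace_aeval_sum_smul (by rw [hV, Fintype.card_fin]) hu1 hα1 hαu huu
    (fun i j hij => (hαβu i j hij).1)]
  refine Finset.sum_congr rfl fun ε _ => ?_
  simp [signSum]

end Hamiltonian

end FermiQuadratic

end

theorem proposition2 {V : Type*} [NormedAddCommGroup V] [InnerProductSpace ℂ V]
    [FiniteDimensional ℂ V] (n : ℕ) (hV : Module.finrank ℂ V = 2 ^ n)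
    (c : Fin n → Module.End ℂ V) (hc : FermiQuadratic.IsFermi c)
    (A B : Matrix (Fin n) (Fin n) ℝ) (hA : A.transpose = A) (hB : B.transpose = -B)
    (hs : FermiQuadratic.sigma (A + B) ≠ 0) (E : ℝ) :
    |1 / (2 : ℝ) ^ n *
        ((Finset.univ.filter fun k : Fin (2 ^ n) =>
          (FermiQuadratic.energyLevel hV hA hB c k - A.trace / 2) /
            (Real.sqrt n * FermiQuadratic.sigma (A + B)) < E).card : ℝ) -
      1 / Real.sqrt (2 * Real.pi) * ∫ x in Set.Iic E, Real.exp (-x ^ 2 / 2)| ≤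
    6 / Real.sqrt n * (FermiQuadratic.rhoCubed (A + B) / FermiQuadratic.sigma (A + B) ^ 3) := by
  obtain ⟨P, Q, l, hP, hQ, hl, hX, hl2, hl3⟩ := FermiQuadratic.exists_svd (A + B)
  set σ := FermiQuadratic.sigma (A + B) with hσ
  have hσ0 : 0 < σ := (Real.sqrt_nonneg _).lt_of_ne' hs
  have hn : (0 : ℝ) < n := by
    refine (Nat.cast_nonneg n).lt_of_ne fun h => hs ?_
    rw [hσ, FermiQuadratic.sigma, ← h]
    simp
  set r := Real.sqrt n with hr
  have hr0 : 0 < r := Real.sqrt_pos.2 hn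
  have hrr : r ^ 2 = n := Real.sq_sqrt hn.le
  have hσ2 : σ ^ 2 = 1 / (4 * (n : ℝ)) * ∑ k, l k ^ 2 := by
    rw [hσ, FermiQuadratic.sigma, ← hl2, Real.sq_sqrt]
    exact mul_nonneg (by positivity) (Finset.sum_nonneg fun k _ => sq_nonneg _)
  set a : Fin n → ℝ := fun k => l k / 2 / (r * σ) with ha
  have ha0 : ∀ k, 0 ≤ a k := fun k => div_nonneg (div_nonneg (hl k) two_pos.le) (by positivity)
  have ha2 : ∑ k, a k ^ 2 = 1 := by
    simp only [ha, div_pow]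
    rw [← Finset.sum_div, ← Finset.sum_div, mul_pow, hrr, hσ2]
    have : ∑ k, l k ^ 2 ≠ 0 := fun h => by
      rw [h, mul_zero] at hσ2
      exact hσ0.ne' (pow_eq_zero_iff two_ne_zero |>.1 hσ2)
    field_simp
    norm_num
  have ha3 : 6 * ∑ k, a k ^ 3 =
      6 / r * (FermiQuadratic.rhoCubed (A + B) / σ ^ 3) := by
    simp only [ha, div_pow]
    rw [← Finset.sum_div, ← Finset.sum_div, FermiQuadratic.rhoCubed, ← hl3, ← hrr]
    field_simp
    norm_num
  have hcount : ((Finset.univ.filter fun k : Fin (2 ^ n) =>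
      (FermiQuadratic.energyLevel hV hA hB c k - A.trace / 2) / (r * σ) < E).card : ℝ) =
      ∑ ε, if FermiQuadratic.signSum a ε < E then (1 : ℝ) else 0 := by
    rw [Finset.natCast_card_filter, FermiQuadratic.sum_energyLevel_eq hV hc hA hB hP hQ hX
      (fun x => if (x - A.trace / 2) / (r * σ) < E then (1 : ℝ) else 0)]
    refine Finset.sum_congr rfl fun ε _ => ?_
    rw [add_sub_cancel_left, FermiQuadratic.signSum, Finset.sum_div]
    simp only [FermiQuadratic.signSum, ha, mul_div_assoc]
  have h := FermiQuadratic.signSum_berryEsseen ha0 ha2 E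
  rw [Fintype.card_fin, ← hcount, ha3] at h
  rw [one_div_mul_eq_div (Real.sqrt (2 * Real.pi))]
  exact h
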